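/- Work in Cantor space $2^\omega$ with the fair-coin measure $\mu$, and for $A,B\in 2^\omega$ let $A\oplus B$ be the sequence with $(A\oplus B)(2n)=A(n)$ and $(A\oplus B)(2n+1)=B(n)$. A basic open set is the empty set or a set $[\sigma]=\{X\in 2^\omega : X \succ \sigma\}$ with $\sigma\in 2^{<\omega}$. A Schnorr test is a sequence $\langle U_n\rangle_{n\in\mathbb N}$ of uniformly $\Sigma^0_1$ subsets of $2^\omega$ (that is, $U_n=\bigcup_s C_{n,s}$ for a computable double sequence $\langle C_{n,s}\rangle$ of basic open sets) such that $\mu(U_n)\le 2^{-n}$ for all $n$ and $\mu(U_n)$ is computable uniformly in $n$. A sequence $X\in 2^\omega$ is Schnorr random if there is no Schnorr test $\langle U_n\rangle$ with $X\in\bigcap_n U_n$. A function $f\in\mathbb N^{\mathbb N}$ encodes a sequence $\langle U_n\rangle$ of open sets with $\mu(U_n)\le 2^{-n}$ if it encodes, for each $n$, a list of basic open sets with union $U_n$ and a sequence $\langle q_k\rangle$ of rationals with limit $\mu(U_n)$ such that $|q_k-q_m|\le 2^{-m}$ for all $k\ge m$. A uniform Schnorr test is a collection $\langle U^X_n\rangle_{n\in\mathbb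 N,\,X\in 2^\omega}$ for which there is a total computable map $\Phi\colon 2^\omega\to\mathbb N^{\mathbb N}$ such that, for every $X\in 2^\omega$, $\Phi(X)$ encodes $\langle U^X_n\rangle_{n\in\mathbb N}$. Say that $B$ is Schnorr random uniformly relative to $A$ if there is no uniform Schnorr test $\langle U^X_n\rangle$ with $B\in\bigcap_n U^A_n$. Theorem. For all $A,B\in 2^\omega$, $A\oplus B$ is Schnorr random if and only if $A$ is Schnorr random and $B$ is Schnorr random uniformly relative to $A$. -/

import Mathlib

open MeasureTheory Filter Topology

namespace SchnorrVL

/-- Cantor space `2^ω`; a set of natural numbers is identified with its characteristic sequence. -/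
abbrev Cantor : Type := ℕ → Bool

/-- The fair-coin measure on `2^ω`: the product of the uniform measures on `{0, 1}`. -/
noncomputable def coinMeasure : Measure Cantor :=
  Measure.infinitePi fun _ : ℕ => (PMF.uniformOfFintype Bool).toMeasure

/-- The initial segment of `X` of length `k`. -/
def initSeg (X : Cantor) (k : ℕ) : List Bool :=
  (List.range k).map X

/-- The set `[σ]` of all `X` that extend the finite string `σ`. -/
def strCylinder (σ : List Bool) : Set Cantor :=
  {X | initSeg X σ.length = σ}

/-- The join `A ⊕ B`: `A` on the even positions and `B` on the odd positions. -/
def cantorJoin (A B : Cantor) : Cantor :=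
  fun n => if n % 2 = 0 then A (n / 2) else B (n / 2)

/-- The basic open sets: the cylinders and the empty set. -/
def basicOpen : Option (List Bool) → Set Cantor
  | none => ∅
  | some σ => strCylinder σ

/-- The basic open set with a given natural number as code. The encoding of `o` is a code of
`basicOpen o`; a number that encodes nothing is one more code of the empty set. -/
def basicOpenOfCode (c : ℕ) : Set Cantor :=
  basicOpen (Encodable.decode (α := Option (List Bool)) c).join

/-- The open set with code `c`, a sequence of (codes of) basic open sets. -/
def openOfCode (c : ℕ → ℕ) : Set Cantor :=
  ⋃ s, basicOpenOfCode (c s)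

/-- The rational number with code `⟨⟨a, b⟩, d⟩`, namely `(a - b) / (d + 1)`. -/
def ratOfCode (c : ℕ) : ℚ :=
  ((c.unpair.1.unpair.1 : ℚ) - (c.unpair.1.unpair.2 : ℚ)) / ((c.unpair.2 : ℚ) + 1)

/-- `q` is (codes rationals that form) a fast Cauchy sequence with limit `x`. -/
def IsFastCauchyCode (q : ℕ → ℕ) (x : ℝ) : Prop :=
  (∀ m n, m ≤ n → |ratOfCode (q n) - ratOfCode (q m)| ≤ (1 / 2 : ℚ) ^ m) ∧
    Tendsto (fun n => ((ratOfCode (q n) : ℚ) : ℝ)) atTop (𝓝 x)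

/-- `U` is a uniform sequence of `Σ⁰₁` subsets of `2^ω`. -/
def UniformlySigma01 (U : ℕ → Set Cantor) : Prop :=
  ∃ c : ℕ → ℕ → ℕ, Computable₂ c ∧ ∀ n, U n = openOfCode (c n)

/-- `x` is a uniformly computable sequence of real numbers. -/
def UniformlyComputable (x : ℕ → ℝ) : Prop :=
  ∃ q : ℕ → ℕ → ℕ, Computable₂ q ∧ ∀ n, IsFastCauchyCode (q n) (x n)

/-- Martin-Löf tests. -/
def IsMartinLofTest (U : ℕ → Set Cantor) : Prop :=
  UniformlySigma01 U ∧ ∀ n, coinMeasure (U n) ≤ (1 / 2) ^ n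

/-- Schnorr tests. -/
def IsSchnorrTest (U : ℕ → Set Cantor) : Prop :=
  IsMartinLofTest U ∧ UniformlyComputable fun n => coinMeasure.real (U n)

/-- `A` is Schnorr random if no Schnorr test covers it. -/
def SchnorrRandom (A : Cantor) : Prop :=
  ¬ ∃ U, IsSchnorrTest U ∧ A ∈ ⋂ n, U n

/-- `f ∈ ℕ^ℕ` encodes the (possibly noncomputable) Schnorr test `U`: its even part lists, for
each `n`, basic open sets with union `U n`, and its odd part gives, for each `n`, a fast Cauchy
sequence of rationals that converges to the measure of `U n`. -/
structure EncodesSchnorrTest (f : ℕ → ℕ) (U : ℕ → Set Cantor) : Prop where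
  open_eq : ∀ n, U n = openOfCode fun s => f (2 * Nat.pair n s)
  measure_le : ∀ n, coinMeasure (U n) ≤ (1 / 2) ^ n
  measure_code : ∀ n,
    IsFastCauchyCode (fun k => f (2 * Nat.pair n k + 1)) (coinMeasure.real (U n))

/-- `Φ : 2^ω → ℕ^ℕ` is a total computable map: some computable procedure `φ`, given a finite
initial segment of the oracle `X` and an argument `n`, either returns a value or asks for more of
the oracle; every value it returns is `Φ X n`, and it does return a value on some initial segment
of each `X`. -/
def TotalComputable (Φ : Cantor → ℕ → ℕ) : Prop :=
  ∃ φ : List Bool → ℕ → Option ℕ, Computable₂ φ ∧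
    ∀ X n, (∃ k, φ (initSeg X k) n = some (Φ X n)) ∧
      ∀ k m, φ (initSeg X k) n = some m → m = Φ X n

/-- The collection `U X n` is a uniform Schnorr test: a total computable map sends each
`X ∈ 2^ω` to a code of the Schnorr test `U X`. -/
def IsUniformSchnorrTest (U : Cantor → ℕ → Set Cantor) : Prop :=
  ∃ Φ : Cantor → ℕ → ℕ, TotalComputable Φ ∧ ∀ X, EncodesSchnorrTest (Φ X) (U X)

/-- `A` is Schnorr random uniformly relative to `B`. -/
def SchnorrRandomUniformlyRel (A B : Cantor) : Prop :=
  ¬ ∃ U, IsUniformSchnorrTest U ∧ A ∈ ⋂ n, U B n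

end SchnorrVL

/-! The notion of randomness has a Borel–Cantelli form: `A` fails to be Schnorr random iff `A` lies
in infinitely many members of some uniformly computable sequence of clopen sets `C m` with
`μ (C m) ≤ 2⁻ᵐ`. Given such a sequence, the unions `⋃ j, C (n + 1 + j)` form a Schnorr test, whose
measures are computable because the tails are small. Conversely, computability of `μ (U n)` lets us
exhaust `U n` by clopen stages at any prescribed computable rate, and the differences of
consecutive stages serve as the `C m`.

If `A ⊕ B` is not Schnorr random, take `C` for it with `μ (C m) ≤ 4⁻ᵐ`. By Fubini's theorem and
Markov's inequality, the clopen set of those `X` for which the section `{Y | X ⊕ Y ∈ C m}` has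
measure more than `2⁻ᵐ` has itself measure at most `2⁻ᵐ`. If `A` is in infinitely many of these
sets, it is not Schnorr random; otherwise, deleting the large sections from the `C m` leaves the
Borel–Cantelli form of a uniform test that captures `B` relative to `A`.

In the other direction, a test for `A` pulls back along `X ⊕ Y ↦ X`, and a uniform Schnorr test `U`
yields the Schnorr test `{X ⊕ Y | Y ∈ U X n}`: by compactness a total computable map has a
computable bound on the part of the oracle that it uses, so the measure is, by Fubini's theorem, an
integral that is approximated by finite averages. -/

namespace SchnorrVL

attribute [fun_prop] Computable Computable.const Computable.pair Computable.cond
  Computable.option_getD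

section ComputableFunctions

variable {α β γ σ : Type*} [Primcodable α] [Primcodable β] [Primcodable γ] [Primcodable σ]

@[fun_prop]
theorem computable_id : Computable fun a : α => a := Computable.id

@[fun_prop]
theorem computable_comp {f : β → σ} {g : α → β} (hf : Computable f) (hg : Computable g) :
    Computable fun a => f (g a) :=
  hf.comp hg

@[fun_prop]
theorem computable_fst {f : α → β × γ} (hf : Computable f) : Computable fun a => (f a).1 :=
  Computable.fst.comp hf

@[fun_prop]
theorem computable_snd {f : α → β × γ} (hf : Computable f) : Computable fun a => (f a).2 :=
  Computable.snd.comp hf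

@[fun_prop]
theorem computable_add {f g : α → ℕ} (hf : Computable f) (hg : Computable g) :
    Computable fun a => f a + g a :=
  Primrec.nat_add.to_comp.comp hf hg

@[fun_prop]
theorem computable_sub {f g : α → ℕ} (hf : Computable f) (hg : Computable g) :
    Computable fun a => f a - g a :=
  Primrec.nat_sub.to_comp.comp hf hg

@[fun_prop]
theorem computable_mul {f g : α → ℕ} (hf : Computable f) (hg : Computable g) :
    Computable fun a => f a * g a :=
  Primrec.nat_mul.to_comp.comp hf hg

@[fun_prop]
theorem computable_pow {f g : α → ℕ} (hf : Computable f) (hg : Computable g) :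
    Computable fun a => f a ^ g a :=
  (Primrec₂.unpaired'.1 Nat.Primrec.pow).to_comp.comp hf hg

@[fun_prop]
theorem computable_div {f g : α → ℕ} (hf : Computable f) (hg : Computable g) :
    Computable fun a => f a / g a :=
  Primrec.nat_div.to_comp.comp hf hg

@[fun_prop]
theorem computable_mod {f g : α → ℕ} (hf : Computable f) (hg : Computable g) :
    Computable fun a => f a % g a :=
  Primrec.nat_mod.to_comp.comp hf hg

@[fun_prop]
theorem computable_natPair {f g : α → ℕ} (hf : Computable f) (hg : Computable g) :
    Computable fun a => Nat.pair (f a) (g a) :=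
  Primrec₂.natPair.to_comp.comp hf hg

@[fun_prop]
theorem computable_unpair {f : α → ℕ} (hf : Computable f) :
    Computable fun a => Nat.unpair (f a) :=
  Computable.unpair.comp hf

@[fun_prop]
theorem computable_decide_lt {f g : α → ℕ} (hf : Computable f) (hg : Computable g) :
    Computable fun a => decide (f a < g a) :=
  Primrec.nat_lt.decide.to_comp.comp hf hg

@[fun_prop]
theorem computable_decide_eq [DecidableEq β] {f g : α → β} (hf : Computable f)
    (hg : Computable g) : Computable fun a => decide (f a = g a) :=
  (Primrec.eq (α := β)).decide.to_comp.comp hf hg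

@[fun_prop]
theorem computable_and {f g : α → Bool} (hf : Computable f) (hg : Computable g) :
    Computable fun a => f a && g a :=
  Primrec.and.to_comp.comp hf hg

@[fun_prop]
theorem computable_or {f g : α → Bool} (hf : Computable f) (hg : Computable g) :
    Computable fun a => f a || g a :=
  Primrec.or.to_comp.comp hf hg

@[fun_prop]
theorem computable_not {f : α → Bool} (hf : Computable f) : Computable fun a => !f a :=
  Primrec.not.to_comp.comp hf

@[fun_prop]
theorem computable_take {f : α → ℕ} {g : α → List β} (hf : Computable f) (hg : Computable g) :
    Computable fun a => (g a).take (f a) :=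
  Primrec.list_take.to_comp.comp hf hg

@[fun_prop]
theorem computable_length {f : α → List β} (hf : Computable f) :
    Computable fun a => (f a).length :=
  Computable.list_length.comp hf

@[fun_prop]
theorem computable_getD {f : α → List β} {g : α → ℕ} (hf : Computable f) (hg : Computable g)
    (d : β) : Computable fun a => (f a).getD (g a) d :=
  (Primrec.list_getD d).to_comp.comp hf hg

@[fun_prop]
theorem computable_encode {f : α → β} (hf : Computable f) :
    Computable fun a => Encodable.encode (f a) :=
  Computable.encode.comp hf

@[fun_prop]
theorem computable_decode {f : α → ℕ} (hf : Computable f) :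
    Computable fun a => (Encodable.decode (f a) : Option β) :=
  Computable.decode.comp hf

@[fun_prop]
theorem computable_some {f : α → β} (hf : Computable f) : Computable fun a => some (f a) :=
  Computable.option_some.comp hf

@[fun_prop]
theorem computable_join {f : α → Option (Option β)} (hf : Computable f) :
    Computable fun a => (f a).join :=
  (Computable.option_bind hf (g := fun _ o => o) Computable.snd).of_eq fun a => by
    cases f a <;> rfl

@[fun_prop]
theorem computable_elim {f : α → Option β} {g : α → σ} {h : α → β → σ} (hf : Computable f)
    (hg : Computable g) (hh : Computable fun x : α × β => h x.1 x.2) :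
    Computable fun a => (f a).elim (g a) (h a) :=
  (Computable.option_casesOn hf hg hh).of_eq fun a => by cases f a <;> rfl

@[fun_prop]
theorem computable_isSome {f : α → Option β} (hf : Computable f) :
    Computable fun a => (f a).isSome :=
  Primrec.option_isSome.to_comp.comp hf

@[fun_prop]
theorem computable_rec {f : α → ℕ} {g : α → σ} {h : α → ℕ → σ → σ} (hf : Computable f)
    (hg : Computable g) (hh : Computable fun x : α × ℕ × σ => h x.1 x.2.1 x.2.2) :
    Computable fun a => Nat.rec (motive := fun _ => σ) (g a) (h a) (f a) :=
  Computable.nat_rec (h := fun a x => h a x.1 x.2) hf hg hh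

@[fun_prop]
theorem computable_sum {f : α → ℕ} {g : α → ℕ → ℕ} (hf : Computable f)
    (hg : Computable fun x : α × ℕ => g x.1 x.2) :
    Computable fun a => ∑ i ∈ Finset.range (f a), g a i := by
  refine (computable_rec (g := fun _ => 0) (h := fun a i y => y + g a i) hf (by fun_prop)
    (by fun_prop)).of_eq fun a => ?_
  induction f a <;> simp [Finset.sum_range_succ, *]

@[fun_prop]
theorem computable_any {f : α → ℕ} {g : α → ℕ → Bool} (hf : Computable f)
    (hg : Computable fun x : α × ℕ => g x.1 x.2) :
    Computable fun a => (List.range (f a)).any (g a) := by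
  refine (computable_rec (g := fun _ => false) (h := fun a i y => y || g a i) hf (by fun_prop)
    (by fun_prop)).of_eq fun a => ?_
  induction f a <;> simp [List.range_succ, *]

@[fun_prop]
theorem computable_all {f : α → ℕ} {g : α → ℕ → Bool} (hf : Computable f)
    (hg : Computable fun x : α × ℕ => g x.1 x.2) :
    Computable fun a => (List.range (f a)).all (g a) := by
  refine (computable_rec (g := fun _ => true) (h := fun a i y => y && g a i) hf (by fun_prop)
    (by fun_prop)).of_eq fun a => ?_
  induction f a <;> simp [List.range_succ, *]

@[fun_prop]
theorem computable_map {f : α → ℕ} {g : α → ℕ → β} (hf : Computable f)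
    (hg : Computable fun x : α × ℕ => g x.1 x.2) :
    Computable fun a => (List.range (f a)).map (g a) := by
  refine (computable_rec (g := fun _ => []) (h := fun a i y => y ++ [g a i]) hf (by fun_prop)
    (Computable.list_concat.comp (by fun_prop) (by fun_prop))).of_eq fun a => ?_
  induction f a <;> simp [List.range_succ, *]

@[fun_prop]
theorem computable_testBit {f g : α → ℕ} (hf : Computable f) (hg : Computable g) :
    Computable fun a => (f a).testBit (g a) :=
  (show Computable fun a => decide (f a / 2 ^ g a % 2 = 1) by fun_prop).of_eq fun a => by
    rw [Nat.testBit_eq_decide_div_mod_eq]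

theorem exists_computable_of_forall_exists {p : α × ℕ → Bool} (hp : Computable p)
    (h : ∀ a, ∃ n, p (a, n)) : ∃ f : α → ℕ, Computable f ∧ ∀ a, p (a, f a) :=
  ⟨fun a => Nat.find (h a), Computable.find ⟨inferInstance, hp.of_eq fun a => by simp⟩ h,
    fun a => Nat.find_spec (h a)⟩

end ComputableFunctions

section RationalCodes

/-- A code of the natural number `n`. -/
def natCode (n : ℕ) : ℕ :=
  Nat.pair (Nat.pair n 0) 0

/-- A code of the sum of two coded rationals. The denominators `d + 1` and `e + 1` multiply to
`(d * e + d + e) + 1`. -/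
def addCode (c d : ℕ) : ℕ :=
  Nat.pair
    (Nat.pair
      (c.unpair.1.unpair.1 * (d.unpair.2 + 1) + d.unpair.1.unpair.1 * (c.unpair.2 + 1))
      (c.unpair.1.unpair.2 * (d.unpair.2 + 1) + d.unpair.1.unpair.2 * (c.unpair.2 + 1)))
    (c.unpair.2 * d.unpair.2 + c.unpair.2 + d.unpair.2)

/-- A code of `2⁻ᵉ` times the rational with code `c`. -/
def scaleCode (c e : ℕ) : ℕ :=
  Nat.pair c.unpair.1 ((c.unpair.2 + 1) * 2 ^ e - 1)

theorem ratOfCode_natCode (n : ℕ) : ratOfCode (natCode n) = n := by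
  simp [ratOfCode, natCode]

theorem ratOfCode_addCode (c d : ℕ) : ratOfCode (addCode c d) = ratOfCode c + ratOfCode d := by
  simp only [ratOfCode, addCode, Nat.unpair_pair]
  push_cast
  rw [show (c.unpair.2 * d.unpair.2 + c.unpair.2 + d.unpair.2 + 1 : ℚ) =
    (c.unpair.2 + 1) * (d.unpair.2 + 1) by ring]
  field_simp
  ring

theorem ratOfCode_scaleCode (c e : ℕ) :
    ratOfCode (scaleCode c e) = ratOfCode c * (1 / 2) ^ e := by
  have hpos : 1 ≤ (c.unpair.2 + 1) * 2 ^ e := Nat.mul_pos (Nat.succ_pos _) (Nat.two_pow_pos e)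
  simp only [ratOfCode, scaleCode, Nat.unpair_pair, Nat.cast_sub hpos]
  push_cast
  rw [sub_add_cancel, one_div, inv_pow, ← div_eq_mul_inv, div_div]

/-- A code of the mean of the rationals coded by `f 0, …, f (2ᴸ - 1)`. -/
def meanCode (f : ℕ → ℕ) (L : ℕ) : ℕ :=
  scaleCode (Nat.rec (motive := fun _ => ℕ) (natCode 0) (fun i c => addCode c (f i)) (2 ^ L)) L

theorem ratOfCode_meanCode (f : ℕ → ℕ) (L : ℕ) :
    ratOfCode (meanCode f L) = (∑ i ∈ Finset.range (2 ^ L), ratOfCode (f i)) * (1 / 2) ^ L := by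
  have hsum (n : ℕ) :
      ratOfCode (Nat.rec (motive := fun _ => ℕ) (natCode 0) (fun i c => addCode c (f i)) n) =
        ∑ i ∈ Finset.range n, ratOfCode (f i) := by
    induction n with
    | zero => simp [ratOfCode_natCode]
    | succ n ih => rw [Finset.sum_range_succ, ratOfCode_addCode, ih]
  rw [meanCode, ratOfCode_scaleCode, hsum]

variable {α : Type*} [Primcodable α]

@[fun_prop]
theorem computable_addCode {f g : α → ℕ} (hf : Computable f) (hg : Computable g) :
    Computable fun a => addCode (f a) (g a) := by
  unfold addCode
  fun_prop

@[fun_prop]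
theorem computable_scaleCode {f g : α → ℕ} (hf : Computable f) (hg : Computable g) :
    Computable fun a => scaleCode (f a) (g a) := by
  unfold scaleCode
  fun_prop

@[fun_prop]
theorem computable_meanCode {f : α → ℕ → ℕ} {L : α → ℕ}
    (hf : Computable fun x : α × ℕ => f x.1 x.2) (hL : Computable L) :
    Computable fun a => meanCode (f a) (L a) := by
  unfold meanCode
  fun_prop

theorem ratOfCode_lt_iff (c d : ℕ) : ratOfCode c < ratOfCode d ↔
    c.unpair.1.unpair.1 * (d.unpair.2 + 1) + d.unpair.1.unpair.2 * (c.unpair.2 + 1) <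
      d.unpair.1.unpair.1 * (c.unpair.2 + 1) + c.unpair.1.unpair.2 * (d.unpair.2 + 1) := by
  rw [ratOfCode, ratOfCode, div_lt_div_iff₀ (by positivity) (by positivity),
    ← Nat.cast_lt (α := ℚ)]
  push_cast
  constructor <;> intro h <;> linarith

@[fun_prop]
theorem computable_decide_ratOfCode_lt {f g : α → ℕ} (hf : Computable f) (hg : Computable g) :
    Computable fun a => decide (ratOfCode (f a) < ratOfCode (g a)) := by
  refine Computable.of_eq (computable_decide_lt ?_ ?_) fun a =>
    (decide_eq_decide.2 (ratOfCode_lt_iff (f a) (g a))).symm <;> fun_prop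

end RationalCodes

section Strings

@[simp]
theorem length_initSeg (X : Cantor) (k : ℕ) : (initSeg X k).length = k := by simp [initSeg]

theorem initSeg_eq_initSeg_iff {X Y : Cantor} {k : ℕ} :
    initSeg X k = initSeg Y k ↔ ∀ i < k, X i = Y i := by
  simp [initSeg]

theorem take_initSeg (X : Cantor) {j k : ℕ} (h : j ≤ k) : (initSeg X k).take j = initSeg X j := by
  simp [initSeg, ← List.map_take, List.take_range, h]

/-- The infinite sequence that continues a finite string with zeros. -/
def extend (σ : List Bool) : Cantor := fun i => σ.getD i false

theorem extend_initSeg (X : Cantor) {i k : ℕ} (h : i < k) : extend (initSeg X k) i = X i := by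
  simp [extend, initSeg, h]

theorem initSeg_extend (σ : List Bool) : initSeg (extend σ) σ.length = σ := by
  apply List.ext_getElem <;> simp +contextual [initSeg, extend]

theorem initSeg_extend_initSeg (X : Cantor) {j k : ℕ} (h : j ≤ k) :
    initSeg (extend (initSeg X k)) j = initSeg X j :=
  initSeg_eq_initSeg_iff.2 fun _ hi => extend_initSeg X (hi.trans_le h)

/-- The string of the first `L` binary digits of `b`, the least significant digit first. For
`b < 2 ^ L` this enumerates the strings of length `L`. -/
def bitStr (L b : ℕ) : List Bool := initSeg b.testBit L

@[simp]
theorem length_bitStr (L b : ℕ) : (bitStr L b).length = L := length_initSeg _ _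

theorem bitStr_injOn (L : ℕ) : Set.InjOn (bitStr L) {b | b < 2 ^ L} := by
  refine fun b hb c hc h => Nat.eq_of_testBit_eq fun i => ?_
  by_cases hi : i < L
  · exact initSeg_eq_initSeg_iff.1 h i hi
  · have hpow : 2 ^ L ≤ 2 ^ i := Nat.pow_le_pow_right two_pos (not_lt.1 hi)
    rw [Nat.testBit_lt_two_pow (hb.trans_le hpow), Nat.testBit_lt_two_pow (hc.trans_le hpow)]

theorem exists_bitStr_eq (X : Cantor) (L : ℕ) : ∃ b < 2 ^ L, bitStr L b = initSeg X L :=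
  ⟨Nat.ofBits fun i : Fin L => X i, Nat.ofBits_lt_two_pow _,
    initSeg_eq_initSeg_iff.2 fun i hi => by simp [hi]⟩

variable {α : Type*} [Primcodable α]

@[fun_prop]
theorem computable_initSeg {X : α → Cantor} {k : α → ℕ}
    (hX : Computable fun x : α × ℕ => X x.1 x.2) (hk : Computable k) :
    Computable fun a => initSeg (X a) (k a) := by
  unfold initSeg
  fun_prop

@[fun_prop]
theorem computable_extend {f : α → List Bool} {g : α → ℕ} (hf : Computable f)
    (hg : Computable g) : Computable fun a => extend (f a) (g a) := by
  unfold extend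
  fun_prop

@[fun_prop]
theorem computable_bitStr {f g : α → ℕ} (hf : Computable f) (hg : Computable g) :
    Computable fun a => bitStr (f a) (g a) := by
  unfold bitStr
  fun_prop

end Strings

section Parts

/-- The left inverse of the join in its first argument: the bits of `Z` at even positions. -/
def evenPart (Z : Cantor) : Cantor := fun n => Z (2 * n)

/-- The left inverse of the join in its second argument: the bits of `Z` at odd positions. -/
def oddPart (Z : Cantor) : Cantor := fun n => Z (2 * n + 1)

@[simp]
theorem evenPart_cantorJoin (X Y : Cantor) : evenPart (cantorJoin X Y) = X := by
  ext n
  simp [evenPart, cantorJoin]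

@[simp]
theorem oddPart_cantorJoin (X Y : Cantor) : oddPart (cantorJoin X Y) = Y := by
  ext n
  simp [oddPart, cantorJoin, Nat.mul_add_div]

@[simp]
theorem cantorJoin_evenPart_oddPart (Z : Cantor) : cantorJoin (evenPart Z) (oddPart Z) = Z := by
  ext n
  rcases Nat.even_or_odd' n with ⟨k, rfl | rfl⟩ <;>
    simp [evenPart, oddPart, cantorJoin, Nat.mul_add_div]

theorem initSeg_evenPart_extend (Z : Cantor) {k l : ℕ} (h : 2 * k ≤ l) :
    initSeg (evenPart (extend (initSeg Z l))) k = initSeg (evenPart Z) k :=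
  initSeg_eq_initSeg_iff.2 fun i hi => extend_initSeg Z (by omega)

theorem initSeg_oddPart_extend (Z : Cantor) {k l : ℕ} (h : 2 * k ≤ l) :
    initSeg (oddPart (extend (initSeg Z l))) k = initSeg (oddPart Z) k :=
  initSeg_eq_initSeg_iff.2 fun i hi => extend_initSeg Z (by omega)

theorem initSeg_cantorJoin_extend_left (X Y : Cantor) {k l : ℕ} (h : k ≤ l) :
    initSeg (cantorJoin (extend (initSeg X l)) Y) k = initSeg (cantorJoin X Y) k :=
  initSeg_eq_initSeg_iff.2 fun i hi => by
    rw [cantorJoin, cantorJoin, extend_initSeg X (by omega)]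

theorem initSeg_cantorJoin_extend_right (X Y : Cantor) {k l : ℕ} (h : k ≤ l) :
    initSeg (cantorJoin X (extend (initSeg Y l))) k = initSeg (cantorJoin X Y) k :=
  initSeg_eq_initSeg_iff.2 fun i hi => by
    rw [cantorJoin, cantorJoin, extend_initSeg Y (by omega)]

@[fun_prop]
theorem continuous_evenPart : Continuous evenPart := by
  unfold evenPart
  fun_prop

@[fun_prop]
theorem continuous_oddPart : Continuous oddPart := by
  unfold oddPart
  fun_prop

@[fun_prop]
theorem measurable_cantorJoin : Measurable fun z : Cantor × Cantor => cantorJoin z.1 z.2 := by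
  refine measurable_pi_lambda _ fun n => ?_
  unfold cantorJoin
  split_ifs <;> fun_prop

variable {α : Type*} [Primcodable α]

@[fun_prop]
theorem computable_evenPart {X : α → Cantor} {k : α → ℕ}
    (hX : Computable fun x : α × ℕ => X x.1 x.2) (hk : Computable k) :
    Computable fun a => evenPart (X a) (k a) := by
  unfold evenPart
  fun_prop

@[fun_prop]
theorem computable_oddPart {X : α → Cantor} {k : α → ℕ}
    (hX : Computable fun x : α × ℕ => X x.1 x.2) (hk : Computable k) :
    Computable fun a => oddPart (X a) (k a) := by
  unfold oddPart
  fun_prop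

@[fun_prop]
theorem computable_cantorJoin {X Y : α → Cantor} {k : α → ℕ}
    (hX : Computable fun x : α × ℕ => X x.1 x.2) (hY : Computable fun x : α × ℕ => Y x.1 x.2)
    (hk : Computable k) : Computable fun a => cantorJoin (X a) (Y a) (k a) :=
  (show Computable fun a => bif decide (k a % 2 = 0) then X a (k a / 2) else Y a (k a / 2) by
    fun_prop).of_eq fun a => by
      by_cases h : k a % 2 = 0 <;> simp [cantorJoin, h]

end Parts

section Measure

instance : IsProbabilityMeasure coinMeasure := by
  unfold coinMeasure
  infer_instance

theorem isOpen_setOf_initSeg (P : List Bool → Prop) (L : ℕ) : IsOpen {X | P (initSeg X L)} := by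
  have hc : Continuous fun (X : Cantor) (i : Fin L) => X i := by fun_prop
  convert! (isOpen_discrete {f : Fin L → Bool | P (List.ofFn f)}).preimage hc using 1
  ext X
  simp [initSeg, List.ofFn_eq_map, ← List.map_coe_finRange_eq_range, Function.comp_def]

theorem measurableSet_strCylinder (σ : List Bool) : MeasurableSet (strCylinder σ) :=
  (isOpen_setOf_initSeg (· = σ) σ.length).measurableSet

theorem coinMeasure_strCylinder (σ : List Bool) :
    coinMeasure (strCylinder σ) = (1 / 2) ^ σ.length := by
  have h : strCylinder σ = Set.pi (Finset.range σ.length) fun i => {extend σ i} := by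
    ext X
    have := initSeg_eq_initSeg_iff (X := X) (Y := extend σ) (k := σ.length)
    rw [initSeg_extend] at this
    simp [strCylinder, this]
  rw [h, coinMeasure, Measure.infinitePi_pi _ fun _ _ => MeasurableSet.singleton _]
  simp

theorem comp_initSeg_eq_sum (g : List Bool → ℝ) (L : ℕ) (X : Cantor) :
    g (initSeg X L) = ∑ b ∈ Finset.range (2 ^ L),
      (strCylinder (bitStr L b)).indicator (fun _ => g (bitStr L b)) X := by
  obtain ⟨b, hb, h⟩ := exists_bitStr_eq X L
  rw [Finset.sum_eq_single_of_mem b (Finset.mem_range.2 hb),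
    Set.indicator_of_mem (by simp [strCylinder, h]), h]
  refine fun c hc hcb => Set.indicator_of_notMem (fun hX => hcb ?_) _
  simp only [strCylinder, length_bitStr, Set.mem_ofPred_eq] at hX
  exact bitStr_injOn L (Finset.mem_range.1 hc) hb (hX.symm.trans h.symm)

theorem integrable_indicator_strCylinder (σ : List Bool) (r : ℝ) :
    Integrable ((strCylinder σ).indicator fun _ => r) coinMeasure :=
  (integrable_const r).indicator (measurableSet_strCylinder σ)

theorem integrable_comp_initSeg (g : List Bool → ℝ) (L : ℕ) :
    Integrable (fun X => g (initSeg X L)) coinMeasure := by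
  simp_rw [comp_initSeg_eq_sum g L]
  exact integrable_finsetSum _ fun b _ => integrable_indicator_strCylinder _ _

theorem integral_comp_initSeg (g : List Bool → ℝ) (L : ℕ) :
    ∫ X, g (initSeg X L) ∂coinMeasure =
      (∑ b ∈ Finset.range (2 ^ L), g (bitStr L b)) * (1 / 2) ^ L := by
  simp_rw [comp_initSeg_eq_sum g L]
  rw [integral_finsetSum _ fun b _ => integrable_indicator_strCylinder _ _, Finset.sum_mul]
  refine Finset.sum_congr rfl fun b _ => ?_
  rw [integral_indicator_const _ (measurableSet_strCylinder _), measureReal_def,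
    coinMeasure_strCylinder]
  simp [mul_comm]

theorem exists_integralCode {ι : Type*} [Primcodable ι] {f : ι × List Bool → ℕ}
    (hf : Computable f) {u : ι → ℕ} (hu : Computable u) : ∃ q : ι → ℕ, Computable q ∧ ∀ i,
      (ratOfCode (q i) : ℝ) = ∫ X, (ratOfCode (f (i, initSeg X (u i))) : ℝ) ∂coinMeasure := by
  refine ⟨fun i => meanCode (fun b => f (i, bitStr (u i) b)) (u i), by fun_prop, fun i => ?_⟩
  rw [integral_comp_initSeg (fun σ => (ratOfCode (f (i, σ)) : ℝ)), ratOfCode_meanCode]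
  push_cast
  rfl

theorem measurePreserving_precomp {f : ℕ → ℕ} (hf : f.Injective) :
    MeasurePreserving (fun Z : Cantor => fun n => Z (f n)) coinMeasure coinMeasure :=
  ⟨by fun_prop, Measure.map_infinitePi_infinitePi_of_inj hf⟩

theorem measurePreserving_evenPart : MeasurePreserving evenPart coinMeasure coinMeasure :=
  measurePreserving_precomp (mul_right_injective₀ two_ne_zero)

theorem measurePreserving_oddPart : MeasurePreserving oddPart coinMeasure coinMeasure :=
  measurePreserving_precomp ((add_left_injective 1).comp (mul_right_injective₀ two_ne_zero))

open ProbabilityTheory in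
theorem indepFun_precomp {f g : ℕ → ℕ} (hfg : Disjoint (Set.range f) (Set.range g)) :
    IndepFun (fun Z : Cantor => fun n => Z (f n)) (fun Z : Cantor => fun n => Z (g n))
      coinMeasure := by
  have hcoord : iIndepFun (fun (i : ℕ) (Z : Cantor) => Z i) coinMeasure :=
    iIndepFun_infinitePi (X := fun _ => id) fun _ => measurable_id
  have hcomap (f : ℕ → ℕ) : MeasurableSpace.comap (fun Z : Cantor => fun n => Z (f n)) inferInstance
      ≤ ⨆ i ∈ Set.range f, MeasurableSpace.comap (fun Z : Cantor => Z i) inferInstance := by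
    simp only [MeasurableSpace.pi, MeasurableSpace.comap_iSup, MeasurableSpace.comap_comp]
    exact iSup_le fun n => le_biSup (fun i => MeasurableSpace.comap (fun Z : Cantor => Z i) _)
      (Set.mem_range_self n)
  rw [IndepFun_iff_Indep]
  exact indep_of_indep_of_le_left (indep_of_indep_of_le_right
    (indep_iSup_of_disjoint (fun i => (measurable_pi_apply i).comap_le)
      ((iIndepFun_iff_iIndep _ _ _).1 hcoord) hfg) (hcomap g)) (hcomap f)

theorem measurePreserving_evenPart_oddPart :
    MeasurePreserving (fun Z => (evenPart Z, oddPart Z)) coinMeasure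
      (coinMeasure.prod coinMeasure) := by
  refine ⟨by fun_prop, ?_⟩
  have hindep : ProbabilityTheory.IndepFun evenPart oddPart coinMeasure :=
    indepFun_precomp <| Set.disjoint_left.2 fun _ ⟨m, hm⟩ ⟨n, hn⟩ => by
      simp only at hm hn
      omega
  rw [hindep.map_prod_eq_prod_map_map (by fun_prop) (by fun_prop),
    measurePreserving_evenPart.map_eq, measurePreserving_oddPart.map_eq]

theorem lintegral_coinMeasure_cantorJoin {V : Set Cantor} (hV : MeasurableSet V) :
    ∫⁻ X, coinMeasure (cantorJoin X ⁻¹' V) ∂coinMeasure = coinMeasure V := by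
  have hW := measurable_cantorJoin hV
  have hpre : (fun Z => (evenPart Z, oddPart Z)) ⁻¹'
      ((fun z : Cantor × Cantor => cantorJoin z.1 z.2) ⁻¹' V) = V := by
    ext Z
    simp
  rw [← hpre, measurePreserving_evenPart_oddPart.measure_preimage hW.nullMeasurableSet,
    Measure.prod_apply hW, hpre]
  rfl

theorem measurable_coinMeasure_cantorJoin {V : Set Cantor} (hV : MeasurableSet V) :
    Measurable fun X => coinMeasure (cantorJoin X ⁻¹' V) :=
  measurable_measure_prodMk_left (measurable_cantorJoin hV)

theorem integral_coinMeasure_cantorJoin {V : Set Cantor} (hV : MeasurableSet V) :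
    ∫ X, coinMeasure.real (cantorJoin X ⁻¹' V) ∂coinMeasure = coinMeasure.real V := by
  rw [measureReal_def, ← lintegral_coinMeasure_cantorJoin hV]
  exact integral_toReal (measurable_coinMeasure_cantorJoin hV).aemeasurable
    (ae_of_all _ fun X => measure_lt_top _ _)

theorem measureReal_le_half_pow_iff {Ω : Type*} [MeasurableSpace Ω] {μ : Measure Ω}
    [IsFiniteMeasure μ] {S : Set Ω} {n : ℕ} : μ.real S ≤ (1 / 2) ^ n ↔ μ S ≤ (1 / 2) ^ n := by
  have h : ((1 / 2 : ENNReal) ^ n).toReal = (1 / 2) ^ n := by simp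
  rw [← h, measureReal_def, ENNReal.toReal_le_toReal (by finiteness) (by finiteness)]

theorem measure_iUnion_le_half_pow {Ω : Type*} [MeasurableSpace Ω] {μ : Measure Ω}
    {S : ℕ → Set Ω} {a : ℕ} (h : ∀ j, μ (S j) ≤ (1 / 2) ^ (a + 1 + j)) :
    μ (⋃ j, S j) ≤ (1 / 2) ^ a := by
  refine (measure_iUnion_le _).trans ((ENNReal.tsum_le_tsum h).trans_eq ?_)
  simp_rw [pow_add]
  rw [ENNReal.tsum_mul_left, ENNReal.tsum_geometric, one_div, ENNReal.one_sub_inv_two, inv_inv,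
    mul_assoc, pow_one, ENNReal.inv_mul_cancel (by norm_num) (by norm_num), mul_one]

end Measure

section OpenCodes

/-- The string `σ` for which `c` is a code of `[σ]`, or `none` if `c` is a code of the empty set. -/
def strOfCode (c : ℕ) : Option (List Bool) :=
  (Encodable.decode (α := Option (List Bool)) c).join

@[fun_prop]
theorem computable_strOfCode {α : Type*} [Primcodable α] {f : α → ℕ} (hf : Computable f) :
    Computable fun a => strOfCode (f a) := by
  unfold strOfCode
  fun_prop

theorem mem_basicOpenOfCode {c : ℕ} {X : Cantor} :
    X ∈ basicOpenOfCode c ↔ ∃ σ, strOfCode c = some σ ∧ X ∈ strCylinder σ := by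
  rw [basicOpenOfCode, ← strOfCode]
  cases strOfCode c <;> simp [basicOpen]

theorem basicOpenOfCode_encode (o : Option (List Bool)) :
    basicOpenOfCode (Encodable.encode o) = basicOpen o := by
  simp [basicOpenOfCode]

theorem iUnion_openOfCode (c : ℕ → ℕ → ℕ) :
    ⋃ j, openOfCode (c j) = openOfCode fun s => c s.unpair.1 s.unpair.2 :=
  (Set.iUnion_unpair fun j t => basicOpenOfCode (c j t)).symm

end OpenCodes

/-- A uniformly computable family of clopen sets: whether `X` belongs to `C i` is decided by a
computable test `p` of the first `u i` bits of `X`, where `u` is computable. -/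
def ComputableClopen {ι : Type*} [Primcodable ι] (C : ι → Set Cantor) : Prop :=
  ∃ (u : ι → ℕ) (p : ι × List Bool → Bool), Computable u ∧ Computable p ∧
    ∀ i X, X ∈ C i ↔ p (i, initSeg X (u i))

namespace ComputableClopen

variable {ι κ : Type*} [Primcodable ι] [Primcodable κ] {C D : ι → Set Cantor}

theorem isOpen (hC : ComputableClopen C) (i : ι) : IsOpen (C i) := by
  obtain ⟨u, p, -, -, h⟩ := hC
  convert! isOpen_setOf_initSeg (fun σ => p (i, σ)) (u i)
  ext X
  exact h i X

theorem measurableSet (hC : ComputableClopen C) (i : ι) : MeasurableSet (C i) :=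
  (hC.isOpen i).measurableSet

theorem comp (hC : ComputableClopen C) {f : κ → ι} (hf : Computable f) :
    ComputableClopen fun k => C (f k) := by
  obtain ⟨u, p, hu, hp, h⟩ := hC
  exact ⟨fun k => u (f k), fun x => p (f x.1, x.2), by fun_prop, by fun_prop, fun k => h (f k)⟩

theorem diff (hC : ComputableClopen C) (hD : ComputableClopen D) :
    ComputableClopen fun i => C i \ D i := by
  obtain ⟨u, p, hu, hp, hC⟩ := hC
  obtain ⟨v, r, hv, hr, hD⟩ := hD
  refine ⟨fun i => u i + v i, fun x => p (x.1, x.2.take (u x.1)) && !r (x.1, x.2.take (v x.1)),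
    by fun_prop, by fun_prop, fun i X => ?_⟩
  simp [hC, hD, take_initSeg]

theorem biUnion_lt {C : ι × ℕ → Set Cantor} (hC : ComputableClopen C) {f : ι → ℕ}
    (hf : Computable f) : ComputableClopen fun i => ⋃ t < f i, C (i, t) := by
  obtain ⟨u, p, hu, hp, h⟩ := hC
  refine ⟨fun i => ∑ t ∈ Finset.range (f i), u (i, t),
    fun x => (List.range (f x.1)).any fun t => p ((x.1, t), x.2.take (u (x.1, t))),
    by fun_prop, by fun_prop, fun i X => ?_⟩
  have hle (t : ℕ) (ht : t < f i) : u (i, t) ≤ ∑ t ∈ Finset.range (f i), u (i, t) :=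
    Finset.single_le_sum_of_canonicallyOrdered (f := fun t => u (i, t)) (Finset.mem_range.2 ht)
  simp only [Set.mem_iUnion, List.any_eq_true, List.mem_range, exists_prop, h]
  exact exists_congr fun t => and_congr_right fun ht => by rw [take_initSeg X (hle t ht)]

/-- Both the point and, through finitely many bits of `Z`, the index may depend on `Z`. The
modulus `w` bounds the bits of `Z` that the first `k` bits of `F i Z` depend on. -/
theorem preimage_of_modulus {D : κ → Set Cantor} (hD : ComputableClopen D)
    {g : ι × List Bool → κ} (hg : Computable g) {v : ι → ℕ} (hv : Computable v)
    {F : ι → Cantor → Cantor}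
    (hF : Computable fun x : (ι × List Bool) × ℕ => F x.1.1 (extend x.1.2) x.2)
    {w : ℕ → ℕ} (hw : Computable w)
    (hFw : ∀ i Z k l, w k ≤ l → initSeg (F i (extend (initSeg Z l))) k = initSeg (F i Z) k) :
    ComputableClopen fun i => {Z | F i Z ∈ D (g (i, initSeg Z (v i)))} := by
  obtain ⟨u, p, hu, hp, h⟩ := hD
  let N (i : ι) : ℕ := ∑ b ∈ Finset.range (2 ^ v i), w (u (g (i, bitStr (v i) b)))
  have hN (i : ι) (Z : Cantor) : w (u (g (i, initSeg Z (v i)))) ≤ v i + N i := by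
    obtain ⟨b, hb, hbZ⟩ := exists_bitStr_eq Z (v i)
    rw [← hbZ]
    exact (Finset.single_le_sum_of_canonicallyOrdered
      (f := fun b => w (u (g (i, bitStr (v i) b)))) (Finset.mem_range.2 hb)).trans
      (Nat.le_add_left _ _)
  refine ⟨fun i => v i + N i, fun x => p (g (x.1, x.2.take (v x.1)),
    initSeg (F x.1 (extend x.2)) (u (g (x.1, x.2.take (v x.1))))), by fun_prop, ?_,
    fun i Z => ?_⟩
  · have hσ : Computable fun x : ι × List Bool => g (x.1, x.2.take (v x.1)) := by fun_prop
    exact hp.comp (hσ.pair (computable_initSeg hF (hu.comp hσ)))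
  · simp only [take_initSeg Z (Nat.le_add_right (v i) _), Set.mem_ofPred_eq, h]
    rw [hFw i Z _ _ (hN i Z)]

theorem preimage_evenPart (hC : ComputableClopen C) :
    ComputableClopen fun i => evenPart ⁻¹' C i :=
  hC.preimage_of_modulus (g := Prod.fst) (v := fun _ => 0) (F := fun _ => evenPart)
    (w := fun k => 2 * k) Computable.fst (Computable.const 0) (by fun_prop) (by fun_prop)
    fun _ Z k l hl => initSeg_evenPart_extend Z hl

theorem preimage_oddPart_of_evenPart {D : ι × List Bool → Set Cantor} (hD : ComputableClopen D)
    {v : ι → ℕ} (hv : Computable v) :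
    ComputableClopen fun i => {Z | oddPart Z ∈ D (i, initSeg (evenPart Z) (v i))} := by
  simpa only [initSeg_evenPart_extend _ le_rfl] using
    hD.preimage_of_modulus (g := fun x => (x.1, initSeg (evenPart (extend x.2)) (v x.1)))
      (v := fun i => 2 * v i) (F := fun _ => oddPart) (w := fun k => 2 * k)
      (by fun_prop) (by fun_prop) (by fun_prop) (by fun_prop)
      fun _ Z k l hl => initSeg_oddPart_extend Z hl

theorem preimage_oddPart (hC : ComputableClopen C) :
    ComputableClopen fun i => oddPart ⁻¹' C i :=
  (hC.comp Computable.fst).preimage_oddPart_of_evenPart (Computable.const 0)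

theorem preimage_cantorJoin (hC : ComputableClopen C) :
    ComputableClopen fun x : ι × List Bool => cantorJoin (extend x.2) ⁻¹' C x.1 :=
  hC.preimage_of_modulus (g := fun x : (ι × List Bool) × List Bool => x.1.1)
    (v := fun _ => 0) (F := fun x => cantorJoin (extend x.2)) (w := fun k => k)
    (by fun_prop) (Computable.const 0) (by fun_prop) (by fun_prop)
    fun x Y k l hl => initSeg_cantorJoin_extend_right _ Y hl

theorem exists_preimage_cantorJoin_eq (hC : ComputableClopen C) : ∃ u : ι → ℕ, Computable u ∧
    ∀ i X, cantorJoin X ⁻¹' C i = cantorJoin (extend (initSeg X (u i))) ⁻¹' C i := by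
  obtain ⟨u, p, hu, -, h⟩ := hC
  refine ⟨u, hu, fun i X => Set.ext fun Y => ?_⟩
  rw [Set.mem_preimage, Set.mem_preimage, h, h, initSeg_cantorJoin_extend_left X Y le_rfl]

theorem exists_measureCode (hC : ComputableClopen C) : ∃ q : ι → ℕ, Computable q ∧
    ∀ i, (ratOfCode (q i) : ℝ) = coinMeasure.real (C i) := by
  have hmeas := hC.measurableSet
  obtain ⟨u, p, hu, hp, h⟩ := hC
  obtain ⟨q, hq, hqC⟩ := exists_integralCode
    (f := fun x => bif p x then natCode 1 else natCode 0) (by fun_prop) hu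
  refine ⟨q, hq, fun i => ?_⟩
  rw [hqC, ← integral_indicator_one (hmeas i)]
  refine integral_congr_ae (ae_of_all _ fun X => ?_)
  by_cases hX : X ∈ C i
  · simp [hX, (h i X).1 hX, ratOfCode_natCode]
  · simp [hX, Bool.eq_false_iff.2 (mt (h i X).2 hX), ratOfCode_natCode]

theorem exists_openCode (hC : ComputableClopen C) : ∃ c : ι × ℕ → ℕ, Computable c ∧
    ∀ i, C i = openOfCode fun s => c (i, s) := by
  obtain ⟨u, p, hu, hp, h⟩ := hC
  refine ⟨fun x => Encodable.encode
    (bif p (x.1, bitStr (u x.1) x.2) then some (bitStr (u x.1) x.2) else none),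
    by fun_prop, fun i => Set.ext fun X => ?_⟩
  simp only [openOfCode, Set.mem_iUnion, basicOpenOfCode_encode, h]
  constructor
  · intro hX
    obtain ⟨b, -, hb⟩ := exists_bitStr_eq X (u i)
    exact ⟨b, by simp [hb, hX, basicOpen, strCylinder]⟩
  · rintro ⟨b, hb⟩
    by_cases hp : p (i, bitStr (u i) b)
    · have hX : initSeg X (u i) = bitStr (u i) b := by
        simpa [hp, basicOpen, strCylinder] using hb
      rwa [hX]
    · simp [hp, basicOpen] at hb

end ComputableClopen

theorem computableClopen_basicOpenOfCode : ComputableClopen basicOpenOfCode := by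
  refine ⟨fun c => (strOfCode c).elim 0 List.length,
    fun x => decide (strOfCode x.1 = some x.2), by fun_prop, by fun_prop, fun c X => ?_⟩
  rw [mem_basicOpenOfCode, decide_eq_true_eq]
  dsimp only
  rcases strOfCode c with - | σ <;> simp [strCylinder, eq_comm]

theorem isOpen_openOfCode (c : ℕ → ℕ) : IsOpen (openOfCode c) :=
  isOpen_iUnion fun _ => computableClopen_basicOpenOfCode.isOpen _

theorem UniformlySigma01.measurableSet {U : ℕ → Set Cantor} (hU : UniformlySigma01 U) (n : ℕ) :
    MeasurableSet (U n) := by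
  obtain ⟨c, -, h⟩ := hU
  exact h n ▸ (isOpen_openOfCode (c n)).measurableSet

theorem monotone_biUnion_lt {α : Type*} (S : ℕ → Set α) : Monotone fun k => ⋃ j < k, S j :=
  fun _ _ hkl => Set.iUnion₂_mono' fun j hj => ⟨j, hj.trans_le hkl, subset_rfl⟩

theorem iUnion_biUnion_lt {α : Type*} (S : ℕ → Set α) : ⋃ k, ⋃ j < k, S j = ⋃ j, S j :=
  (Set.iUnion_subset fun _ => Set.iUnion₂_subset_iUnion _ _).antisymm <| Set.iUnion_subset fun j =>
    Set.subset_iUnion_of_subset (j + 1) (Set.subset_iUnion₂ (s := fun i (_ : i < j + 1) => S i)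
      j j.lt_succ_self)

section FastCauchyCodes

theorem IsFastCauchyCode.abs_sub_le_of_le {q : ℕ → ℕ} {x : ℝ} (h : IsFastCauchyCode q x) {m n : ℕ}
    (hmn : m ≤ n) : |(ratOfCode (q n) : ℝ) - ratOfCode (q m)| ≤ (1 / 2) ^ m := by
  have hq := h.1 m n hmn
  rw [← Rat.cast_le (K := ℝ)] at hq
  push_cast at hq
  exact hq

theorem IsFastCauchyCode.abs_sub_le {q : ℕ → ℕ} {x : ℝ} (h : IsFastCauchyCode q x) (m : ℕ) :
    |x - ratOfCode (q m)| ≤ (1 / 2) ^ m :=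
  le_of_tendsto (h.2.sub_const _).abs
    ((eventually_ge_atTop m).mono fun _ hn => h.abs_sub_le_of_le hn)

variable {Ω : Type*} [MeasurableSpace Ω] {μ : Measure Ω} {q : ℕ → ℕ}

theorem isFastCauchyCode_measure_iUnion [IsFiniteMeasure μ] {S : ℕ → Set Ω}
    (hμ : ∀ j, μ (S j) ≤ (1 / 2) ^ (j + 1))
    (hq : ∀ k, (ratOfCode (q k) : ℝ) = μ.real (⋃ j < k, S j)) :
    IsFastCauchyCode q (μ.real (⋃ j, S j)) := by
  have hmono : Monotone fun k => μ.real (⋃ j < k, S j) := fun k l hkl =>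
    measureReal_mono (monotone_biUnion_lt S hkl) (measure_ne_top _ _)
  have hle (k : ℕ) : μ.real (⋃ j < k, S j) ≤ μ.real (⋃ j, S j) :=
    measureReal_mono (Set.iUnion₂_subset_iUnion _ _)
  have hge (k : ℕ) : μ.real (⋃ j, S j) ≤ μ.real (⋃ j < k, S j) + (1 / 2) ^ k := by
    have htail : μ.real (⋃ j, S (k + j)) ≤ (1 / 2) ^ k :=
      measureReal_le_half_pow_iff.2 (measure_iUnion_le_half_pow fun j =>
        (hμ (k + j)).trans_eq (by ring))
    have hsub : ⋃ j, S j ⊆ (⋃ j < k, S j) ∪ ⋃ j, S (k + j) := Set.iUnion_subset fun j => by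
      rcases lt_or_ge j k with hj | hj
      · exact (Set.subset_iUnion₂ (s := fun j (_ : j < k) => S j) j hj).trans Set.subset_union_left
      · obtain ⟨i, rfl⟩ := Nat.exists_eq_add_of_le hj
        exact (Set.subset_iUnion (fun i => S (k + i)) i).trans Set.subset_union_right
    exact (measureReal_mono hsub).trans ((measureReal_union_le _ _).trans
      (add_le_add_right htail _))
  constructor
  · intro m n hmn
    rw [← Rat.cast_le (K := ℝ)]
    push_cast
    rw [hq, hq, abs_of_nonneg (sub_nonneg.2 (hmono hmn))]
    linarith [hle n, hge m]
  · simp_rw [hq]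
    refine tendsto_of_tendsto_of_tendsto_of_le_of_le
      (g := fun k => μ.real (⋃ j, S j) - (1 / 2) ^ k) ?_ tendsto_const_nhds
      (fun k => sub_le_iff_le_add.2 (hge k)) hle
    simpa using tendsto_const_nhds.sub
      (tendsto_pow_atTop_nhds_zero_of_lt_one (r := (1 / 2 : ℝ)) (by norm_num) (by norm_num))

theorem isFastCauchyCode_integral [IsProbabilityMeasure μ] {f : Ω → ℕ → ℕ} {g : Ω → ℝ}
    (hf : ∀ ω, IsFastCauchyCode (f ω) (g ω))
    (hint : ∀ k, Integrable (fun ω => (ratOfCode (f ω k) : ℝ)) μ)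
    (hq : ∀ k, (ratOfCode (q k) : ℝ) = ∫ ω, (ratOfCode (f ω k) : ℝ) ∂μ) :
    IsFastCauchyCode q (∫ ω, g ω ∂μ) := by
  constructor
  · intro m n hmn
    rw [← Rat.cast_le (K := ℝ)]
    push_cast
    rw [hq, hq, ← integral_sub (hint n) (hint m)]
    simpa using norm_integral_le_of_norm_le_const (μ := μ)
      (f := fun ω => (ratOfCode (f ω n) : ℝ) - ratOfCode (f ω m))
      (ae_of_all _ fun ω => (hf ω).abs_sub_le_of_le hmn)
  · simp_rw [hq]
    refine tendsto_integral_of_dominated_convergence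
      (fun ω => |(ratOfCode (f ω 0) : ℝ)| + 1) (fun k => (hint k).aestronglyMeasurable)
      ((hint 0).abs.add (integrable_const 1)) (fun k => ae_of_all _ fun ω => ?_)
      (ae_of_all _ fun ω => (hf ω).2)
    have h := (hf ω).abs_sub_le_of_le (Nat.zero_le k)
    rw [pow_zero] at h
    rw [Real.norm_eq_abs]
    linarith [abs_sub_abs_le_abs_sub (ratOfCode (f ω k) : ℝ) (ratOfCode (f ω 0))]

end FastCauchyCodes

section TotalComputable

theorem totalComputable_of_initSeg {v : ℕ → ℕ} {ψ : ℕ × List Bool → ℕ} (hv : Computable v)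
    (hψ : Computable ψ) : TotalComputable fun X i => ψ (i, initSeg X (v i)) := by
  refine ⟨fun σ i => bif decide (σ.length < v i) then none else some (ψ (i, σ.take (v i))),
    show Computable fun x : List Bool × ℕ => bif decide (x.1.length < v x.2) then none else
      some (ψ (x.2, x.1.take (v x.2))) by fun_prop, fun X i => ⟨⟨v i, ?_⟩, fun k m h => ?_⟩⟩
  · simp [take_initSeg]
  · rcases lt_or_ge k (v i) with hk | hk
    · simp [hk] at h
    · simpa [hk.not_gt, take_initSeg X hk, eq_comm] using h

theorem TotalComputable.computable_apply {Φ : Cantor → ℕ → ℕ} (hΦ : TotalComputable Φ)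
    {α : Type*} [Primcodable α] {X : α → Cantor} (hX : Computable fun x : α × ℕ => X x.1 x.2)
    {f : α → ℕ} (hf : Computable f) : Computable fun a => Φ (X a) (f a) := by
  obtain ⟨φ, hφ, h⟩ := hΦ
  replace hφ : Computable fun x : List Bool × ℕ => φ x.1 x.2 := hφ
  obtain ⟨k, hk, hks⟩ := exists_computable_of_forall_exists
    (p := fun x : α × ℕ => (φ (initSeg (X x.1) x.2) (f x.1)).isSome) (by fun_prop) fun a =>
    (h (X a) (f a)).1.imp fun k hk => by simp [hk]
  refine (show Computable fun a => (φ (initSeg (X a) (k a)) (f a)).getD 0 by fun_prop).of_eq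
    fun a => ?_
  obtain ⟨m, hm⟩ := Option.isSome_iff_exists.1 (hks a)
  rw [hm, Option.getD_some, (h (X a) (f a)).2 _ _ hm]

theorem exists_uniform_bound_of_forall_exists_initSeg {P : List Bool → Prop}
    (h : ∀ X : Cantor, ∃ k, P (initSeg X k)) : ∃ L, ∀ X : Cantor, ∃ k < L, P (initSeg X k) := by
  obtain ⟨L, hL⟩ := isCompact_univ.elim_directed_cover
    (fun L : ℕ => ⋃ k < L, {X : Cantor | P (initSeg X k)})
    (fun L => isOpen_biUnion fun k _ => isOpen_setOf_initSeg P k)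
    (fun X _ => by
      obtain ⟨k, hk⟩ := h X
      exact Set.mem_iUnion.2 ⟨k + 1, Set.mem_biUnion k.lt_succ_self hk⟩)
    (monotone_biUnion_lt _).directed_le
  exact ⟨L, fun X => by simpa using hL (Set.mem_univ X)⟩

theorem TotalComputable.exists_use {Φ : Cantor → ℕ → ℕ} (hΦ : TotalComputable Φ) :
    ∃ v : ℕ → ℕ, Computable v ∧ ∀ X i, Φ X i = Φ (extend (initSeg X (v i))) i := by
  obtain ⟨φ, hφ, h⟩ := hΦ
  replace hφ : Computable fun x : List Bool × ℕ => φ x.1 x.2 := hφ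
  obtain ⟨v, hv, hvφ⟩ := exists_computable_of_forall_exists
    (p := fun x : ℕ × ℕ => (List.range (2 ^ x.2)).all fun b => (List.range x.2).any fun j =>
      (φ ((bitStr x.2 b).take j) x.1).isSome) (by fun_prop) fun i => by
    obtain ⟨L, hL⟩ := exists_uniform_bound_of_forall_exists_initSeg
      (P := fun σ => (φ σ i).isSome) fun X => (h X i).1.imp fun k hk => by simp [hk]
    refine ⟨L, ?_⟩
    simp only [List.all_eq_true, List.any_eq_true, List.mem_range]
    intro b _
    obtain ⟨j, hj, hs⟩ := hL b.testBit
    exact ⟨j, hj, by rwa [bitStr, take_initSeg _ hj.le]⟩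
  refine ⟨v, hv, fun X i => ?_⟩
  have hX := hvφ i
  simp only [List.all_eq_true, List.any_eq_true, List.mem_range] at hX
  obtain ⟨b, hb, hbX⟩ := exists_bitStr_eq X (v i)
  obtain ⟨j, hj, hs⟩ := hX b hb
  obtain ⟨m, hm⟩ := Option.isSome_iff_exists.1 hs
  rw [hbX, take_initSeg X hj.le] at hm
  rw [← (h X i).2 j m hm, (h (extend (initSeg X (v i))) i).2 j m]
  rwa [initSeg_extend_initSeg X hj.le]

theorem isUniformSchnorrTest_of_initSeg {U : Cantor → ℕ → Set Cantor}
    {c q : (ℕ × ℕ) × List Bool → ℕ} {v w : ℕ × ℕ → ℕ} (hc : Computable c) (hq : Computable q)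
    (hv : Computable v) (hw : Computable w)
    (hU : ∀ X n, U X n = openOfCode fun s => c ((n, s), initSeg X (v (n, s))))
    (hμ : ∀ X n, coinMeasure (U X n) ≤ (1 / 2) ^ n)
    (hqU : ∀ X n, IsFastCauchyCode (fun k => q ((n, k), initSeg X (w (n, k))))
      (coinMeasure.real (U X n))) : IsUniformSchnorrTest U := by
  have hmod (i : ℕ) : (2 * i + 1) % 2 = 1 := by omega
  have hdiv (i : ℕ) : (2 * i + 1) / 2 = i := by omega
  refine ⟨_, totalComputable_of_initSeg
    (v := fun i => bif decide (i % 2 = 0) then v (i / 2).unpair else w (i / 2).unpair)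
    (ψ := fun x => bif decide (x.1 % 2 = 0) then c ((x.1 / 2).unpair, x.2)
      else q ((x.1 / 2).unpair, x.2)) (by fun_prop) (by fun_prop), fun X =>
    ⟨fun n => ?_, hμ X, fun n => ?_⟩⟩
  · simpa using hU X n
  · simpa [hmod, hdiv] using hqU X n

theorem IsUniformSchnorrTest.isSchnorrTest {U : Cantor → ℕ → Set Cantor}
    (hU : IsUniformSchnorrTest U) {X : ℕ → Bool} (hX : Computable X) : IsSchnorrTest (U X) := by
  obtain ⟨Φ, hΦ, hE⟩ := hU
  have hX' : Computable fun x : (ℕ × ℕ) × ℕ => X x.2 := by fun_prop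
  exact ⟨⟨⟨fun n s => Φ X (2 * Nat.pair n s),
    hΦ.computable_apply (f := fun x : ℕ × ℕ => 2 * Nat.pair x.1 x.2) hX' (by fun_prop),
    (hE X).open_eq⟩, (hE X).measure_le⟩, fun n k => Φ X (2 * Nat.pair n k + 1),
    hΦ.computable_apply (f := fun x : ℕ × ℕ => 2 * Nat.pair x.1 x.2 + 1) hX' (by fun_prop),
    (hE X).measure_code⟩

end TotalComputable

section BorelCantelli

theorem isUniformSchnorrTest_iUnion {V : ℕ → Set Cantor} (hV : ComputableClopen V)
    (hμ : ∀ X m, coinMeasure (cantorJoin X ⁻¹' V m) ≤ (1 / 2) ^ m) :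
    IsUniformSchnorrTest fun X n => ⋃ j, cantorJoin X ⁻¹' V (n + 1 + j) := by
  obtain ⟨c, hc, hcV⟩ := hV.preimage_cantorJoin.exists_openCode
  obtain ⟨v, hv, hvV⟩ := hV.exists_preimage_cantorJoin_eq
  let W (x : ℕ × ℕ) : Set Cantor := ⋃ j < x.2, V (x.1 + 1 + j)
  have hW : ComputableClopen W :=
    (hV.comp (f := fun x : (ℕ × ℕ) × ℕ => x.1.1 + 1 + x.2) (by fun_prop)).biUnion_lt
      (f := Prod.snd) (by fun_prop)
  obtain ⟨q, hq, hqW⟩ := hW.preimage_cantorJoin.exists_measureCode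
  obtain ⟨w, hw, hwW⟩ := hW.exists_preimage_cantorJoin_eq
  have hsmall (X : Cantor) (n j : ℕ) :
      coinMeasure (cantorJoin X ⁻¹' V (n + 1 + j)) ≤ (1 / 2) ^ (n + 1 + j) := hμ X _
  refine isUniformSchnorrTest_of_initSeg
    (c := fun x => c ((x.1.1 + 1 + x.1.2.unpair.1, x.2), x.1.2.unpair.2)) (q := q)
    (v := fun x => v (x.1 + 1 + x.2.unpair.1)) (by fun_prop) hq (by fun_prop) hw
    (fun X n => ?_) (fun X n => measure_iUnion_le_half_pow (hsmall X n)) fun X n =>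
    isFastCauchyCode_measure_iUnion (fun j => (hsmall X n j).trans ?_) fun k => ?_
  · rw [← iUnion_openOfCode fun j t =>
      c ((n + 1 + j, initSeg X (v (n + 1 + j))), t)]
    exact Set.iUnion_congr fun j => (hvV _ X).trans (hcV (n + 1 + j, _))
  · exact pow_le_pow_right_of_le_one' (by norm_num) (by omega)
  · rw [hqW, ← hwW, Set.preimage_iUnion₂]

theorem not_schnorrRandomUniformlyRel_of_frequently {V : ℕ → Set Cantor} (hV : ComputableClopen V)
    (hμ : ∀ X m, coinMeasure (cantorJoin X ⁻¹' V m) ≤ (1 / 2) ^ m) {A B : Cantor}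
    (hAB : ∃ᶠ m in atTop, cantorJoin A B ∈ V m) : ¬ SchnorrRandomUniformlyRel B A := by
  refine not_not.2 ⟨_, isUniformSchnorrTest_iUnion hV hμ, Set.mem_iInter.2 fun n => ?_⟩
  obtain ⟨m, hnm, hm⟩ := frequently_atTop.1 hAB (n + 1)
  obtain ⟨j, rfl⟩ := Nat.exists_eq_add_of_le hnm
  exact Set.mem_iUnion.2 ⟨j, hm⟩

theorem not_schnorrRandom_of_frequently {C : ℕ → Set Cantor} (hC : ComputableClopen C)
    (hμ : ∀ m, coinMeasure (C m) ≤ (1 / 2) ^ m) {A : Cantor} (hA : ∃ᶠ m in atTop, A ∈ C m) :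
    ¬ SchnorrRandom A := by
  have hpre (X : Cantor) (m : ℕ) : cantorJoin X ⁻¹' (oddPart ⁻¹' C m) = C m := by
    ext Y
    simp
  have htest := (isUniformSchnorrTest_iUnion hC.preimage_oddPart fun X m => by
    rw [hpre]
    exact hμ m).isSchnorrTest (Computable.const false)
  refine not_not.2 ⟨_, htest, Set.mem_iInter.2 fun n => ?_⟩
  obtain ⟨m, hnm, hm⟩ := frequently_atTop.1 hA (n + 1)
  obtain ⟨j, rfl⟩ := Nat.exists_eq_add_of_le hnm
  exact Set.mem_iUnion.2 ⟨j, by rwa [hpre]⟩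

end BorelCantelli

section Approximation

theorem UniformlySigma01.comp {U : ℕ → Set Cantor} (hU : UniformlySigma01 U) {f : ℕ → ℕ}
    (hf : Computable f) : UniformlySigma01 fun n => U (f n) := by
  obtain ⟨c, hc, h⟩ := hU
  exact ⟨fun n => c (f n), hc.comp (hf.comp Computable.fst) Computable.snd, fun n => h (f n)⟩

theorem UniformlyComputable.comp {x : ℕ → ℝ} (hx : UniformlyComputable x) {f : ℕ → ℕ}
    (hf : Computable f) : UniformlyComputable fun n => x (f n) := by
  obtain ⟨q, hq, h⟩ := hx
  exact ⟨fun n => q (f n), hq.comp (hf.comp Computable.fst) Computable.snd, fun n => h (f n)⟩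

theorem UniformlySigma01.exists_monotone_computableClopen {U : ℕ → Set Cantor}
    (hU : UniformlySigma01 U) : ∃ D : ℕ × ℕ → Set Cantor, ComputableClopen D ∧
      (∀ n, Monotone fun s => D (n, s)) ∧ ∀ n, ⋃ s, D (n, s) = U n := by
  obtain ⟨c, hc, h⟩ := hU
  replace hc : Computable fun x : ℕ × ℕ => c x.1 x.2 := hc
  refine ⟨fun x => ⋃ t < x.2, basicOpenOfCode (c x.1 t),
    (computableClopen_basicOpenOfCode.comp (f := fun x : (ℕ × ℕ) × ℕ => c x.1.1 x.2)
      (by fun_prop)).biUnion_lt (f := Prod.snd) (by fun_prop),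
    fun n => monotone_biUnion_lt fun t => basicOpenOfCode (c n t), fun n => ?_⟩
  rw [h]
  exact iUnion_biUnion_lt fun t => basicOpenOfCode (c n t)

theorem ComputableClopen.exists_stage {D : ℕ × ℕ → Set Cantor} (hD : ComputableClopen D)
    (hmono : ∀ n, Monotone fun s => D (n, s))
    (hμ : UniformlyComputable fun n => coinMeasure.real (⋃ s, D (n, s))) :
    ∃ s : ℕ × ℕ → ℕ, Computable s ∧
      ∀ n e, coinMeasure.real ((⋃ t, D (n, t)) \ D (n, s (n, e))) ≤ (1 / 2) ^ e := by
  obtain ⟨q, hq, hqD⟩ := hμ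
  replace hq : Computable fun x : ℕ × ℕ => q x.1 x.2 := hq
  obtain ⟨r, hr, hrD⟩ := hD.exists_measureCode
  have htest (n e t : ℕ) :
      ratOfCode (q n (e + 2)) < ratOfCode (addCode (r (n, t)) (scaleCode (natCode 1) (e + 1))) ↔
      (ratOfCode (q n (e + 2)) : ℝ) < coinMeasure.real (D (n, t)) + 2 * (1 / 2) ^ (e + 2) := by
    rw [ratOfCode_addCode, ratOfCode_scaleCode, ratOfCode_natCode, ← hrD, ← Rat.cast_lt (K := ℝ)]
    push_cast
    ring_nf
  have hq_near (n e : ℕ) := abs_le.1 ((hqD n).abs_sub_le (e + 2))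
  obtain ⟨s, hs, hsq⟩ := exists_computable_of_forall_exists
    (p := fun x : (ℕ × ℕ) × ℕ => decide (ratOfCode (q x.1.1 (x.1.2 + 2)) <
      ratOfCode (addCode (r (x.1.1, x.2)) (scaleCode (natCode 1) (x.1.2 + 1)))))
    (by fun_prop) fun ⟨n, e⟩ => by
    simp only [decide_eq_true_eq, htest]
    have hlim : Tendsto (fun t => coinMeasure.real (D (n, t))) atTop
        (𝓝 (coinMeasure.real (⋃ t, D (n, t)))) :=
      (ENNReal.tendsto_toReal (measure_ne_top _ _)).comp
        (tendsto_measure_iUnion_atTop (hmono n))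
    obtain ⟨t, ht⟩ := (hlim.eventually (lt_mem_nhds (sub_lt_self _
      (show (0 : ℝ) < (1 / 2) ^ (e + 2) by positivity)))).exists
    exact ⟨t, by linarith [(hq_near n e).1]⟩
  refine ⟨s, hs, fun n e => ?_⟩
  have hlt := (htest n e _).1 (of_decide_eq_true (hsq (n, e)))
  rw [measureReal_sdiff (Set.subset_iUnion (fun t => D (n, t)) _) (hD.measurableSet _)]
  have hpow : (1 / 2 : ℝ) ^ e = 4 * (1 / 2) ^ (e + 2) := by ring
  have hpos : (0 : ℝ) < (1 / 2) ^ (e + 2) := by positivity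
  linarith [(hq_near n e).2]

theorem UniformlySigma01.exists_computableClopen_measure_diff_le {U : ℕ → Set Cantor}
    (hU : UniformlySigma01 U) (hμ : UniformlyComputable fun n => coinMeasure.real (U n))
    {e : ℕ × ℕ → ℕ} (he : Computable e) : ∃ D : ℕ × ℕ → Set Cantor, ComputableClopen D ∧
      (∀ n, ⋃ k, D (n, k) = U n) ∧ ∀ n k, coinMeasure (U n \ D (n, k)) ≤ (1 / 2) ^ e (n, k) := by
  obtain ⟨D, hD, hmono, hDU⟩ := hU.exists_monotone_computableClopen
  simp only [← hDU] at hμ ⊢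
  obtain ⟨s, hs, hsD⟩ := hD.exists_stage hmono hμ
  refine ⟨fun x => D (x.1, x.2 + s (x.1, e x)),
    hD.comp (f := fun x => (x.1, x.2 + s (x.1, e x))) (by fun_prop), fun n => ?_, fun n k => ?_⟩
  · refine Set.Subset.antisymm (Set.iUnion_subset fun k => ?_) (Set.iUnion_mono fun k => ?_)
    · exact Set.subset_iUnion (fun t => D (n, t)) _
    · exact hmono n (Nat.le_add_right k _)
  · exact (measure_mono (Set.sdiff_subset_sdiff_right (hmono n (Nat.le_add_left _ _)))).trans
      (measureReal_le_half_pow_iff.1 (hsD n (e (n, k))))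

/-- The converse of `not_schnorrRandom_of_frequently`, with a freely chosen rate of decay. -/
theorem exists_computableClopen_of_not_schnorrRandom {A : Cantor} (hA : ¬ SchnorrRandom A)
    {e : ℕ → ℕ} (he : Computable e) : ∃ C : ℕ → Set Cantor, ComputableClopen C ∧
      (∀ m, coinMeasure (C m) ≤ (1 / 2) ^ e m) ∧ ∃ᶠ m in atTop, A ∈ C m := by
  obtain ⟨U, ⟨⟨hU, hμ⟩, hμU⟩, hAU⟩ := not_not.1 hA
  -- The zeroth band is all of `D (n, 0)`, so the index of `U` already has to make it small.
  have hN : Computable fun n => e (Nat.pair n 0) := by fun_prop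
  obtain ⟨D, hD, hDU, hDμ⟩ := (hU.comp hN).exists_computableClopen_measure_diff_le (hμU.comp hN)
    (e := fun x => e (Nat.pair x.1 (x.2 + 1))) (by fun_prop)
  let band (n k : ℕ) : Set Cantor := D (n, k) \ ⋃ j < k, D (n, j)
  have hband (n k : ℕ) : coinMeasure (band n k) ≤ (1 / 2) ^ e (Nat.pair n k) := by
    have hsub : D (n, k) ⊆ U (e (Nat.pair n 0)) := hDU n ▸ Set.subset_iUnion (fun k => D (n, k)) k
    rcases k with - | k
    · exact (measure_mono (Set.sdiff_subset.trans hsub)).trans (hμ _)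
    · exact (measure_mono (Set.sdiff_subset_sdiff hsub (Set.subset_iUnion₂
        (s := fun j (_ : j < k + 1) => D (n, j)) k k.lt_succ_self))).trans (hDμ n k)
  refine ⟨fun m => band m.unpair.1 m.unpair.2,
    (hD.comp (f := Nat.unpair) (by fun_prop)).diff
      ((hD.comp (f := fun x : ℕ × ℕ => (x.1.unpair.1, x.2)) (by fun_prop)).biUnion_lt
        (by fun_prop)),
    fun m => by simpa using hband m.unpair.1 m.unpair.2, frequently_atTop.2 fun n => ?_⟩
  have hex : ∃ k, A ∈ D (n, k) := Set.mem_iUnion.1 (hDU n ▸ Set.mem_iInter.1 hAU _)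
  classical
  refine ⟨Nat.pair n (Nat.find hex), Nat.left_le_pair _ _, ?_⟩
  simpa [band] using ⟨Nat.find_spec hex, fun j hj => Nat.find_min hex (Nat.lt_find_iff _ _ |>.2 hj)⟩

end Approximation

section Join

variable {A B : Cantor}

theorem not_schnorrRandom_cantorJoin_of_left (hA : ¬ SchnorrRandom A) :
    ¬ SchnorrRandom (cantorJoin A B) := by
  obtain ⟨C, hC, hμ, hAC⟩ := exists_computableClopen_of_not_schnorrRandom hA Computable.id
  refine not_schnorrRandom_of_frequently hC.preimage_evenPart (fun m => ?_) (by simpa using hAC)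
  rw [measurePreserving_evenPart.measure_preimage (hC.measurableSet m).nullMeasurableSet]
  exact hμ m

theorem uniformlySigma01_setOf_oddPart_mem {Φ : Cantor → ℕ → ℕ} (hΦ : TotalComputable Φ)
    {g : ℕ × ℕ → ℕ} (hg : Computable g) :
    UniformlySigma01 fun n => {Z | oddPart Z ∈ openOfCode fun s => Φ (evenPart Z) (g (n, s))} := by
  obtain ⟨v, hv, hΦv⟩ := hΦ.exists_use
  have hψ : Computable fun x : (ℕ × ℕ) × List Bool => Φ (extend x.2) (g x.1) :=
    hΦ.computable_apply (by fun_prop) (by fun_prop)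
  obtain ⟨c, hc, hcΦ⟩ := ((computableClopen_basicOpenOfCode.comp hψ).preimage_oddPart_of_evenPart
    (v := fun x => v (g x)) (by fun_prop)).exists_openCode
  refine ⟨fun n s => c ((n, s.unpair.1), s.unpair.2),
    show Computable fun x : ℕ × ℕ => c ((x.1, x.2.unpair.1), x.2.unpair.2) by fun_prop,
    fun n => ?_⟩
  rw [← iUnion_openOfCode fun t s => c ((n, t), s)]
  simp_rw [← hcΦ, ← hΦv]
  ext Z
  simp [openOfCode]

theorem uniformlyComputable_integral {Φ : Cantor → ℕ → ℕ} (hΦ : TotalComputable Φ)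
    {g : ℕ × ℕ → ℕ} (hg : Computable g) {x : ℕ → Cantor → ℝ}
    (hx : ∀ X n, IsFastCauchyCode (fun k => Φ X (g (n, k))) (x n X)) :
    UniformlyComputable fun n => ∫ X, x n X ∂coinMeasure := by
  obtain ⟨v, hv, hΦv⟩ := hΦ.exists_use
  have hψ : Computable fun x : (ℕ × ℕ) × List Bool => Φ (extend x.2) (g x.1) :=
    hΦ.computable_apply (by fun_prop) (by fun_prop)
  obtain ⟨q, hq, hqΦ⟩ := exists_integralCode hψ (u := fun x => v (g x))
    (by fun_prop)
  simp only [← hΦv] at hqΦ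
  refine ⟨fun n k => q (n, k), hq, fun n => isFastCauchyCode_integral (hx · n) (fun k => ?_)
    fun k => hqΦ (n, k)⟩
  simpa only [← hΦv] using
    integrable_comp_initSeg (fun σ => (ratOfCode (Φ (extend σ) (g (n, k))) : ℝ)) (v (g (n, k)))

theorem IsUniformSchnorrTest.isSchnorrTest_join {U : Cantor → ℕ → Set Cantor}
    (hU : IsUniformSchnorrTest U) :
    IsSchnorrTest fun n => {Z | oddPart Z ∈ U (evenPart Z) n} := by
  obtain ⟨Φ, hΦ, hE⟩ := hU
  have hopen : UniformlySigma01 fun n => {Z | oddPart Z ∈ U (evenPart Z) n} := by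
    simpa only [← (hE _).open_eq] using uniformlySigma01_setOf_oddPart_mem hΦ
      (g := fun x => 2 * Nat.pair x.1 x.2) (by fun_prop)
  have hsection (X : Cantor) (n : ℕ) :
      cantorJoin X ⁻¹' {Z | oddPart Z ∈ U (evenPart Z) n} = U X n := by
    ext Y
    simp
  have hmeas (n : ℕ) := hopen.measurableSet n
  refine ⟨⟨hopen, fun n => ?_⟩, ?_⟩
  · rw [← lintegral_coinMeasure_cantorJoin (hmeas n)]
    simp_rw [hsection]
    exact (lintegral_mono fun X => (hE X).measure_le n).trans_eq (by simp)
  · simp_rw [← integral_coinMeasure_cantorJoin (hmeas _), hsection]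
    exact uniformlyComputable_integral hΦ (g := fun x => 2 * Nat.pair x.1 x.2 + 1) (by fun_prop)
      fun X n => (hE X).measure_code n

theorem not_schnorrRandom_cantorJoin_of_right (hB : ¬ SchnorrRandomUniformlyRel B A) :
    ¬ SchnorrRandom (cantorJoin A B) := by
  obtain ⟨U, hU, hBU⟩ := not_not.1 hB
  exact not_not.2 ⟨_, hU.isSchnorrTest_join, by simpa using hBU⟩

/-- The `X` whose section of `C m` has measure more than `2⁻ᵐ`. -/
def largeSections (C : ℕ → Set Cantor) (m : ℕ) : Set Cantor :=
  {X | (1 / 2) ^ m < coinMeasure (cantorJoin X ⁻¹' C m)}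

theorem computableClopen_largeSections {C : ℕ → Set Cantor} (hC : ComputableClopen C) :
    ComputableClopen (largeSections C) := by
  obtain ⟨u, hu, huC⟩ := hC.exists_preimage_cantorJoin_eq
  obtain ⟨q, hq, hqC⟩ := hC.preimage_cantorJoin.exists_measureCode
  refine ⟨u, fun x => decide (ratOfCode (scaleCode (natCode 1) x.1) < ratOfCode (q x)), hu,
    by fun_prop, fun m X => ?_⟩
  rw [decide_eq_true_eq, ratOfCode_scaleCode, ratOfCode_natCode, ← Rat.cast_lt (K := ℝ), hqC,
    ← huC, ← not_le, largeSections, Set.mem_ofPred_eq, ← not_le,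
    ← measureReal_le_half_pow_iff]
  simp

theorem coinMeasure_largeSections_le {C : ℕ → Set Cantor} {m : ℕ} (hC : MeasurableSet (C m))
    (hμ : coinMeasure (C m) ≤ (1 / 2) ^ (2 * m)) :
    coinMeasure (largeSections C m) ≤ (1 / 2) ^ m := by
  have hmarkov : (1 / 2) ^ m * coinMeasure (largeSections C m) ≤ (1 / 2) ^ m * (1 / 2) ^ m :=
    calc (1 / 2) ^ m * coinMeasure (largeSections C m)
        ≤ (1 / 2) ^ m * coinMeasure {X | (1 / 2) ^ m ≤ coinMeasure (cantorJoin X ⁻¹' C m)} := by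
          gcongr
          exact Set.ofPred_subset_ofPred.2 fun X => le_of_lt
      _ ≤ ∫⁻ X, coinMeasure (cantorJoin X ⁻¹' C m) ∂coinMeasure :=
          mul_meas_ge_le_lintegral (measurable_coinMeasure_cantorJoin hC) _
      _ = coinMeasure (C m) := lintegral_coinMeasure_cantorJoin hC
      _ ≤ (1 / 2) ^ m * (1 / 2) ^ m := hμ.trans_eq (by rw [two_mul, pow_add])
  exact (ENNReal.mul_le_mul_iff_right (by simp) (by finiteness)).1 hmarkov

theorem not_schnorrRandomUniformlyRel_of_cantorJoin (hAB : ¬ SchnorrRandom (cantorJoin A B))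
    (hA : SchnorrRandom A) : ¬ SchnorrRandomUniformlyRel B A := by
  obtain ⟨C, hC, hμ, hABC⟩ := exists_computableClopen_of_not_schnorrRandom hAB
    (e := fun m => 2 * m) (by fun_prop)
  have hlarge := computableClopen_largeSections hC
  have hfin : ∀ᶠ m in atTop, A ∉ largeSections C m := by
    by_contra hfreq
    exact not_schnorrRandom_of_frequently hlarge
      (fun m => coinMeasure_largeSections_le (hC.measurableSet m) (hμ m))
      (by simpa only [not_eventually, not_not] using hfreq) hA
  refine not_schnorrRandomUniformlyRel_of_frequently (hC.diff hlarge.preimage_evenPart)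
    (fun X m => ?_) ((hABC.and_eventually hfin).mono fun m h => by simpa using h)
  by_cases hX : X ∈ largeSections C m
  · simp [Set.preimage_sdiff, ← Set.preimage_comp, Function.comp_def, hX]
  · exact (measure_mono (Set.preimage_mono Set.sdiff_subset)).trans (not_lt.1 hX)

end Join

end SchnorrVL

theorem theorem4p5 (A B : SchnorrVL.Cantor) :
    SchnorrVL.SchnorrRandom (SchnorrVL.cantorJoin A B) ↔
      SchnorrVL.SchnorrRandom A ∧ SchnorrVL.SchnorrRandomUniformlyRel B A := by
  constructor
  · intro h
    exact ⟨by_contra fun hA => SchnorrVL.not_schnorrRandom_cantorJoin_of_left hA h,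
      by_contra fun hB => SchnorrVL.not_schnorrRandom_cantorJoin_of_right hB h⟩
  · rintro ⟨hA, hB⟩
    exact by_contra fun h => SchnorrVL.not_schnorrRandomUniformlyRel_of_cantorJoin h hA hB
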